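/- Let $\mathbb{D}=\{z\in\mathbb{C}:|z|<1\}$ and $\mathbb{D}_r=\{z\in\mathbb{C}:|z|<r\}$. Let $\mathcal{H}$ be the class of harmonic mappings $f=h+\overline{g}$ of $\mathbb{D}$, with $h,g$ analytic in $\mathbb{D}$, of the form $h(z)=z+\sum_{n\ge 2}a_nz^n$, $g(z)=\sum_{n\ge 1}b_nz^n$, which are sense-preserving, i.e. $|h'|^2-|g'|^2>0$ in $\mathbb{D}$. Let $\mathcal{H}'$ be the class of those $f=h+\overline{g}\in\mathcal{H}$ that can be written in the form $$h(z)=z-\sum_{n=2}^\infty |a_n|z^n,\qquad g(z)=\sum_{n=1}^\infty |b_n|z^n. \qquad (*)$$ For $\lambda\in(-\pi/2,\pi/2)$, a domain $\Omega\subset\mathbb{C}$ containing $0$ is called $\lambda$-spirallike if for every $w_0\in\Omega$ the spiral arc $\{0\}\cup\{w_0\exp(-te^{i\lambda}):t\ge 0\}$ lies in $\Omega$. Let $\mathcal{SP}_{H'}(\lambda)$ be the class of those $f\in\mathcal{H}'$ that are hereditarily $\lambda$-spirallike, i.e. $f$ is univalent in $\mathbb{D}$ and $f(\mathbb{D}_r)$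 is a $\lambda$-spirallike domain for every $0<r<1$. Let $\mathcal{ST}_{H'}$ be the class of those $f\in\mathcal{H}'$ that are hereditarily starlike, i.e. $f$ is univalent in $\mathbb{D}$ and maps every circle $\{|z|=r\}$, $0<r<1$, in a one-to-one manner onto a curve that bounds a (bounded) domain starlike with respect to the origin. **Corollary.** Let $\lambda\in(-\pi/2,\pi/2)$ and let $f=h+\overline{g}\in\mathcal{SP}_{H'}(\lambda)$ be of the form $(*)$. Then, with $a_1=1$, $$\sum_{n=1}^\infty \bigl(n|a_n|+n|b_n|\bigr)\le 2$$ (in particular the series converges), and $f\in\mathcal{ST}_{H'}$. -/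

import Mathlib

namespace HarmonicSpiral

open Metric

/-- The open unit disk of the complex plane. -/
def unitDisk : Set ℂ := ball (0 : ℂ) 1

/-- `f = h + conj g` on the unit disk, with `h` and `g` analytic there: `h` is the analytic part
and `g` the co-analytic part of the harmonic mapping `f`. -/
def IsCanonicalRep (f h g : ℂ → ℂ) : Prop :=
  DifferentiableOn ℂ h unitDisk ∧ DifferentiableOn ℂ g unitDisk ∧
    ∀ z ∈ unitDisk, f z = h z + (starRingEnd ℂ) (g z)

/-- The Jacobian `|h'|^2 - |g'|^2` of `h + conj g` is positive on the unit disk. -/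
def SensePreserving (h g : ℂ → ℂ) : Prop :=
  ∀ z ∈ unitDisk, 0 < ‖deriv h z‖ ^ 2 - ‖deriv g z‖ ^ 2

/-- `h z = z + ∑_{n ≥ 2} a n * z ^ n` and `g z = ∑_{n ≥ 1} b n * z ^ n` on the unit disk. -/
def HasNormalizedForm (h g : ℂ → ℂ) (a b : ℕ → ℂ) : Prop :=
  ∀ z ∈ unitDisk,
    HasSum (fun n : ℕ => a (n + 2) * z ^ (n + 2)) (h z - z) ∧
    HasSum (fun n : ℕ => b (n + 1) * z ^ (n + 1)) (g z)

/-- `h z = z - ∑_{n ≥ 2} |a n| * z ^ n` and `g z = ∑_{n ≥ 1} |b n| * z ^ n` on the unit disk. -/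
def HasSignedForm (h g : ℂ → ℂ) (a b : ℕ → ℂ) : Prop :=
  ∀ z ∈ unitDisk,
    HasSum (fun n : ℕ => (‖a (n + 2)‖ : ℂ) * z ^ (n + 2)) (z - h z) ∧
    HasSum (fun n : ℕ => (‖b (n + 1)‖ : ℂ) * z ^ (n + 1)) (g z)

/-- The class `H` of normalized sense-preserving harmonic mappings of the unit disk. -/
def classH : Set (ℂ → ℂ) :=
  {f | ∃ (h g : ℂ → ℂ) (a b : ℕ → ℂ),
    IsCanonicalRep f h g ∧ SensePreserving h g ∧ HasNormalizedForm h g a b}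

/-- The class `H'` of members of `H` whose analytic part is `z - ∑ |a n| z ^ n` and whose
co-analytic part is `∑ |b n| z ^ n`. -/
def classH' : Set (ℂ → ℂ) :=
  {f | f ∈ classH ∧ ∃ (h g : ℂ → ℂ) (a b : ℕ → ℂ),
    IsCanonicalRep f h g ∧ HasSignedForm h g a b}

/-- The arc of the logarithmic `lam`-spiral from the origin to `w`, with both end points. -/
def spiralArc (lam : ℝ) (w : ℂ) : Set ℂ :=
  insert 0 {u | ∃ t : ℝ, 0 ≤ t ∧ u = w * Complex.exp (-(t * Complex.exp (Complex.I * lam)))}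

/-- A `lam`-spirallike domain (with respect to the origin). -/
def IsSpirallikeDomain (lam : ℝ) (Ω : Set ℂ) : Prop :=
  IsOpen Ω ∧ IsConnected Ω ∧ (0 : ℂ) ∈ Ω ∧ ∀ w ∈ Ω, spiralArc lam w ⊆ Ω

/-- A domain that is starlike with respect to the origin. -/
def IsStarlikeDomain (Ω : Set ℂ) : Prop :=
  IsOpen Ω ∧ IsConnected Ω ∧ (0 : ℂ) ∈ Ω ∧ StarConvex ℝ (0 : ℂ) Ω

/-- `f` is univalent on the unit disk and maps every disk `|z| < r`, `0 < r < 1`, onto a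
`lam`-spirallike domain. -/
def IsHereditarilySpirallike (lam : ℝ) (f : ℂ → ℂ) : Prop :=
  Set.InjOn f unitDisk ∧
    ∀ r : ℝ, 0 < r → r < 1 → IsSpirallikeDomain lam (f '' ball (0 : ℂ) r)

/-- `f` maps every circle `|z| = r`, `0 < r < 1`, in a one-to-one manner onto a curve that bounds
a domain starlike with respect to the origin. -/
def IsFullyStarlike (f : ℂ → ℂ) : Prop :=
  ∀ r : ℝ, 0 < r → r < 1 →
    Set.InjOn f (sphere (0 : ℂ) r) ∧
    ∃ Ω : Set ℂ, IsStarlikeDomain Ω ∧ Bornology.IsBounded Ω ∧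
      frontier Ω = f '' sphere (0 : ℂ) r

/-- Hereditarily starlike: fully starlike and univalent on the unit disk. -/
def IsHereditarilyStarlike (f : ℂ → ℂ) : Prop :=
  IsFullyStarlike f ∧ Set.InjOn f unitDisk

/-- The class of hereditarily `lam`-spirallike members of `H'`. -/
def classSPH' (lam : ℝ) : Set (ℂ → ℂ) :=
  {f | f ∈ classH' ∧ IsHereditarilySpirallike lam f}

/-- The class of hereditarily starlike members of `H'`. -/
def classSTH' : Set (ℂ → ℂ) :=
  {f | f ∈ classH' ∧ IsHereditarilyStarlike f}

end HarmonicSpiral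

open Metric Filter Topology ComplexConjugate

namespace HarmonicSpiral

/-! On the positive radius both derivatives are real, with `g' ≥ 0`. Sense-preservation keeps `h'`
from vanishing there and `h' 0 = 1`, so `h' > g'`, that is, `∑_{n≥2} n|a n|x^n + ∑_{n≥1} n|b n|x^n <
x` for `0 < x < 1`. Letting `x → 1` gives the coefficient bound. By the triangle inequality the same
estimate at `x = |z|` yields `Re (f * conj (z h' - conj (z g'))) > 0` for `z ≠ 0`
(`HasSignedForm.re_pos`). Hence, as a value moves radially towards `0`, its local preimage moves to
smaller modulus, and continuity induction along the segment makes every image disk starlike.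
Univalence of `f` and openness and connectedness of the image disks come from the spirallike
hypothesis. -/

/-- Term-by-term differentiation of a power series that converges on the unit disk. -/
lemma hasSum_deriv_powerSeries {c : ℕ → ℂ} {K : ℂ → ℂ} {k : ℕ}
    (hK : ∀ z ∈ unitDisk, HasSum (fun n => c n * z ^ (n + (k + 1))) (K z))
    {z : ℂ} (hz : z ∈ unitDisk) :
    HasSum (fun n => ((n + (k + 1) : ℕ) : ℂ) * c n * z ^ (n + k)) (deriv K z) := by
  simp only [unitDisk, mem_ball_zero_iff] at hK hz
  -- The series of norms at `R` majorizes all terms on the ball of radius `R`.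
  obtain ⟨R, hzR, hR⟩ := exists_between hz
  have hR0 : 0 < R := (norm_nonneg z).trans_lt hzR
  have hs := (hK (R : ℂ) (by simpa [abs_of_pos hR0] using hR)).summable.norm
  have key := Complex.hasSum_deriv_of_summable_norm (U := ball (0 : ℂ) R) (z := z)
    (F := fun n w => c n * w ^ (n + (k + 1))) hs (fun n => by fun_prop) isOpen_ball
    (fun n w hw => by
      rw [mem_ball_zero_iff] at hw
      simp only [norm_mul, norm_pow, Complex.norm_real, Real.norm_of_nonneg hR0.le]
      gcongr) (by simpa using hzR)
  have heq : (fun w : ℂ => ∑' n, c n * w ^ (n + (k + 1))) =ᶠ[𝓝 z] K := by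
    filter_upwards [isOpen_ball.mem_nhds (by simpa using hzR : z ∈ ball (0 : ℂ) R)] with w hw
    exact (hK w ((mem_ball_zero_iff.1 hw).trans hR)).tsum_eq
  rw [heq.deriv_eq] at key
  have e : (fun n => deriv (fun w : ℂ => c n * w ^ (n + (k + 1))) z) =
      fun n => ((n + (k + 1) : ℕ) : ℂ) * c n * z ^ (n + k) := by
    funext n
    rw [deriv_const_mul_field, deriv_pow_field, show n + (k + 1) - 1 = n + k by omega]
    ring
  rwa [e] at key

/-! ### Differential and local inverse of a harmonic mapping -/

/-- The real differential of `h + conj g` at a point where `h' = p` and `g' = q`. -/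
noncomputable def realDifferential (p q : ℂ) : ℂ →L[ℝ] ℂ :=
  (ContinuousLinearMap.mul ℝ ℂ p) +
    (Complex.conjCLE : ℂ →L[ℝ] ℂ).comp (ContinuousLinearMap.mul ℝ ℂ q)

@[simp] lemma realDifferential_apply (p q v : ℂ) :
    realDifferential p q v = p * v + conj (q * v) := by
  simp [realDifferential]

lemma realDifferential_injective {p q : ℂ} (hpq : 0 < ‖p‖ ^ 2 - ‖q‖ ^ 2) :
    Function.Injective (realDifferential p q) := by
  rw [injective_iff_map_eq_zero]
  intro v hv
  rw [realDifferential_apply, add_eq_zero_iff_eq_neg] at hv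
  have h1 : ‖p‖ * ‖v‖ = ‖q‖ * ‖v‖ := by
    have := congrArg norm hv
    simpa using this
  by_contra hne
  have h2 : ‖p‖ = ‖q‖ := mul_right_cancel₀ (norm_ne_zero_iff.2 hne) h1
  simp [h2] at hpq

/-- The differential determines the derivatives of the analytic and co-analytic parts. -/
lemma realDifferential_inj {p q p' q' : ℂ} (h : realDifferential p q = realDifferential p' q') :
    p = p' ∧ q = q' := by
  have h1 := congrArg (fun L : ℂ →L[ℝ] ℂ => L 1) h
  have h2 := congrArg (fun L : ℂ →L[ℝ] ℂ => L Complex.I) h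
  simp only [realDifferential_apply, Complex.ext_iff] at h1 h2
  simp at h1 h2
  refine ⟨Complex.ext ?_ ?_, Complex.ext ?_ ?_⟩ <;> linarith [h1.1, h1.2, h2.1, h2.2]

lemma hasStrictFDerivAt_harmonic {h g : ℂ → ℂ} (hh : DifferentiableOn ℂ h unitDisk)
    (hg : DifferentiableOn ℂ g unitDisk) {z : ℂ} (hz : z ∈ unitDisk) :
    HasStrictFDerivAt (fun w => h w + conj (g w)) (realDifferential (deriv h z) (deriv g z)) z := by
  have aux : ∀ {k : ℂ → ℂ}, DifferentiableOn ℂ k unitDisk →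
      HasStrictFDerivAt k (ContinuousLinearMap.mul ℝ ℂ (deriv k z)) z := by
    intro k hk
    have := (hk.analyticAt (isOpen_ball.mem_nhds hz)).hasStrictDerivAt.hasStrictFDerivAt.restrictScalars ℝ
    have e : ContinuousLinearMap.restrictScalars ℝ
        (ContinuousLinearMap.toSpanSingleton ℂ (deriv k z)) =
        ContinuousLinearMap.mul ℝ ℂ (deriv k z) := by
      ext v
      simp [mul_comm]
    rwa [e] at this
  exact (aux hh).add ((Complex.conjCLE : ℂ →L[ℝ] ℂ).hasStrictFDerivAt.comp z (aux hg))

/-- Sense-preservation does not depend on the canonical representation. -/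
lemma SensePreserving.of_isCanonicalRep {f h g h₀ g₀ : ℂ → ℂ} (hs : SensePreserving h₀ g₀)
    (h0 : IsCanonicalRep f h₀ g₀) (h1 : IsCanonicalRep f h g) : SensePreserving h g := by
  intro z hz
  have e : (fun w => h w + conj (g w)) =ᶠ[𝓝 z] fun w => h₀ w + conj (g₀ w) := by
    filter_upwards [isOpen_ball.mem_nhds hz] with w hw
    rw [← h0.2.2 w hw, ← h1.2.2 w hw]
  have d1 := (hasStrictFDerivAt_harmonic h1.1 h1.2.1 hz).hasFDerivAt
  have d0 := (hasStrictFDerivAt_harmonic h0.1 h0.2.1 hz).hasFDerivAt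
  obtain ⟨e1, e2⟩ := realDifferential_inj (d1.unique (d0.congr_of_eventuallyEq e))
  rw [e1, e2]
  exact hs z hz

/-- Where `h + conj g` is sense-preserving and the radial derivative condition holds, moving the
value `s • u` towards the origin can be realized without increasing the modulus of the preimage. -/
lemma eventually_exists_preimage_norm_le {h g : ℂ → ℂ} (hh : DifferentiableOn ℂ h unitDisk)
    (hg : DifferentiableOn ℂ g unitDisk) {z u : ℂ} {s : ℝ} (hz : z ∈ unitDisk)
    (hJ : 0 < ‖deriv h z‖ ^ 2 - ‖deriv g z‖ ^ 2)
    (hpos : 0 < (u * conj (z * deriv h z - conj (z * deriv g z))).re)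
    (hs : h z + conj (g z) = s * u) :
    ∀ᶠ x : ℝ in 𝓝[<] s, ∃ w : ℂ, ‖w‖ ≤ ‖z‖ ∧ h w + conj (g w) = x * u := by
  set F : ℂ → ℂ := fun w => h w + conj (g w) with hF
  let L : ℂ ≃L[ℝ] ℂ := (LinearEquiv.ofInjectiveEndo
    (realDifferential (deriv h z) (deriv g z) : ℂ →ₗ[ℝ] ℂ)
    (realDifferential_injective hJ)).toContinuousLinearEquiv
  have hL : (L : ℂ →L[ℝ] ℂ) = realDifferential (deriv h z) (deriv g z) := by
    ext v; simp [L]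
  have hd : HasStrictFDerivAt F (L : ℂ →L[ℝ] ℂ) z := by
    rw [hL]; exact hasStrictFDerivAt_harmonic hh hg hz
  set G := hd.localInverse F L z with hG
  have hFz : F z = (s : ℂ) * u := hs
  have hGz : G (s * u) = z := by rw [← hFz]; exact hd.localInverse_apply_image
  have hline : HasDerivAt (fun x : ℝ => (x : ℂ) * u) u s := by
    simpa using (Complex.ofRealCLM.hasDerivAt (x := s)).mul_const u
  have hGd : HasFDerivAt G (L.symm : ℂ →L[ℝ] ℂ) ((s : ℂ) * u) := by
    rw [← hFz]; exact hd.to_localInverse.hasFDerivAt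
  have hcomp : HasDerivAt (fun x : ℝ => G ((x : ℂ) * u)) (L.symm u) s :=
    HasFDerivAt.comp_hasDerivAt (f := fun x : ℝ => (x : ℂ) * u) s hGd hline
  set v := L.symm u with hv
  have hLv : deriv h z * v + conj (deriv g z * v) = u := by
    rw [← realDifferential_apply, ← hL, hv]; simp
  -- Substituting `u = h' v + conj (g' v)` cancels the cross terms. The Jacobian factors out, so the
  -- radial condition fixes the sign of the derivative of `‖G (x * u)‖ ^ 2`.
  have hnum : (u * conj (z * deriv h z - conj (z * deriv g z))).re
      = (‖deriv h z‖ ^ 2 - ‖deriv g z‖ ^ 2) * (conj z * v).re := by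
    rw [← hLv, ← Complex.normSq_eq_norm_sq, ← Complex.normSq_eq_norm_sq]
    simp [Complex.normSq_apply]
    ring
  have hre : 0 < (conj z * v).re := by
    rw [hnum] at hpos
    exact pos_of_mul_pos_right hpos hJ.le
  have hsq : HasDerivAt (fun x : ℝ => ‖G ((x : ℂ) * u)‖ ^ 2 - ‖z‖ ^ 2) (2 * (conj z * v).re) s := by
    have := (hcomp.norm_sq).sub_const (‖z‖ ^ 2)
    rwa [hGz, Complex.inner, mul_comm v] at this
  have hsign := eventually_nhdsWithin_sign_eq_of_deriv_pos (x₀ := s)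
    (f := fun x : ℝ => ‖G ((x : ℂ) * u)‖ ^ 2 - ‖z‖ ^ 2) (by rw [hsq.deriv]; positivity)
    (by simp [hGz])
  have hright : ∀ᶠ x : ℝ in 𝓝 s, F (G ((x : ℂ) * u)) = x * u := by
    have h1 : Tendsto (fun x : ℝ => (x : ℂ) * u) (𝓝 s) (𝓝 (F z)) := by
      rw [hFz]; exact hline.continuousAt
    exact h1.eventually hd.eventually_right_inverse
  filter_upwards [nhdsWithin_le_nhds hsign, nhdsWithin_le_nhds hright, self_mem_nhdsWithin]
    with x h1 h2 h3
  refine ⟨G (x * u), ?_, h2⟩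
  rw [sign_neg (sub_neg.2 (Set.mem_Iio.1 h3)), sign_eq_neg_one_iff] at h1
  exact (pow_le_pow_iff_left₀ (norm_nonneg _) (norm_nonneg _) two_ne_zero).1 (by linarith)

/-! ### Estimates from the signed coefficients -/

/-- A complex series with real terms has a real sum. -/
lemma hasSum_re_of_eq_ofReal {F : ℕ → ℂ} {c : ℕ → ℝ} {w : ℂ} (hw : HasSum F w)
    (hF : ∀ n, F n = c n) : HasSum c w.re ∧ w.im = 0 := by
  obtain rfl : F = fun n => (c n : ℂ) := funext hF
  exact ⟨by simpa using Complex.hasSum_re hw,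
    (Complex.hasSum_im hw).unique (by simp)⟩

/-- A power series without constant term vanishes at the origin. -/
lemma eq_zero_of_hasSum_zero_pow {c : ℕ → ℂ} {w : ℂ} {k : ℕ}
    (hw : HasSum (fun n => c n * (0 : ℂ) ^ (n + (k + 1))) w) : w = 0 := by
  simp only [← add_assoc, pow_succ, mul_zero] at hw
  exact hw.unique hasSum_zero

section SignedForm

variable {h g : ℂ → ℂ} {a b : ℕ → ℂ}

lemma HasSignedForm.hasSum_deriv_left (hf : HasSignedForm h g a b)
    (hh : DifferentiableOn ℂ h unitDisk) {z : ℂ} (hz : z ∈ unitDisk) :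
    HasSum (fun n : ℕ => ((n + 2 : ℕ) : ℂ) * (‖a (n + 2)‖ : ℂ) * z ^ (n + 1)) (1 - deriv h z) := by
  have := hasSum_deriv_powerSeries (k := 1) (fun z hz => (hf z hz).1) hz
  have hd := (hh.differentiableAt (isOpen_ball.mem_nhds hz)).hasDerivAt
  rwa [((hasDerivAt_id' z).fun_sub hd).deriv] at this

lemma HasSignedForm.hasSum_deriv_right (hf : HasSignedForm h g a b) {z : ℂ} (hz : z ∈ unitDisk) :
    HasSum (fun n : ℕ => ((n + 1 : ℕ) : ℂ) * (‖b (n + 1)‖ : ℂ) * z ^ n) (deriv g z) :=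
  hasSum_deriv_powerSeries (k := 0) (fun z hz => (hf z hz).2) hz

lemma ofReal_mem_unitDisk {x : ℝ} (h0 : 0 ≤ x) (h1 : x < 1) : (x : ℂ) ∈ unitDisk := by
  simpa [unitDisk, abs_of_nonneg h0] using h1

/-- On the positive radius `h'` is real and dominates `g'`. -/
lemma HasSignedForm.re_deriv_lt (hf : HasSignedForm h g a b)
    (hh : DifferentiableOn ℂ h unitDisk) (hs : SensePreserving h g)
    {x : ℝ} (h0 : 0 ≤ x) (h1 : x < 1) : (deriv g x).re < (deriv h x).re := by
  have key : ∀ y : ℝ, 0 ≤ y → y < 1 →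
      0 ≤ (deriv g y).re ∧ (deriv g y).re ^ 2 < (deriv h y).re ^ 2 := by
    intro y hy0 hy1
    have hy := ofReal_mem_unitDisk hy0 hy1
    have sa := hf.hasSum_deriv_left hh hy
    have sb := hf.hasSum_deriv_right hy
    have ea := (hasSum_re_of_eq_ofReal (c := fun n => ((n + 2 : ℕ) : ℝ) * ‖a (n + 2)‖ * y ^ (n + 1))
      sa fun n => by push_cast; rfl).2
    obtain ⟨rb, eb⟩ := hasSum_re_of_eq_ofReal
      (c := fun n => ((n + 1 : ℕ) : ℝ) * ‖b (n + 1)‖ * y ^ n) sb fun n => by push_cast; rfl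
    have pos : 0 ≤ (deriv g y).re := rb.nonneg fun n => by positivity
    have := hs y hy
    rw [← Complex.normSq_eq_norm_sq, ← Complex.normSq_eq_norm_sq, Complex.normSq_apply,
      Complex.normSq_apply] at this
    simp at ea
    rw [ea, eb] at this
    exact ⟨pos, by nlinarith⟩
  have hcont : ContinuousOn (fun y : ℝ => (deriv h y).re) (Set.Icc 0 x) := by
    refine Complex.continuous_re.comp_continuousOn
      ((hh.deriv isOpen_ball).continuousOn.comp Complex.continuous_ofReal.continuousOn ?_)
    exact fun y hy => ofReal_mem_unitDisk hy.1 (hy.2.trans_lt h1)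
  have hzero : deriv h 0 = 1 := by
    exact (sub_eq_zero.1 (eq_zero_of_hasSum_zero_pow (k := 0)
      (hf.hasSum_deriv_left hh (z := 0) (by simp [unitDisk])))).symm
  have hpos : 0 < (deriv h x).re := by
    -- A sign change would give a zero of `h'`, against `g' ^ 2 < h' ^ 2`.
    by_contra! hneg
    obtain ⟨y, hy, hy0⟩ := intermediate_value_Icc' h0 hcont ⟨hneg, by simp [hzero]⟩
    have := (key y hy.1 (hy.2.trans_lt h1)).2
    simp only at hy0
    rw [hy0] at this
    nlinarith [sq_nonneg (deriv g y).re]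
  obtain ⟨k1, k2⟩ := key x h0 h1
  exact lt_of_pow_lt_pow_left₀ 2 hpos.le k2

/-- The real series of `x * (1 - h' x)` and `x * g' x`, whose sum is below `x`. -/
lemma HasSignedForm.exists_hasSum_lt (hf : HasSignedForm h g a b)
    (hh : DifferentiableOn ℂ h unitDisk) (hs : SensePreserving h g)
    {x : ℝ} (h0 : 0 < x) (h1 : x < 1) : ∃ α β : ℝ,
      HasSum (fun n : ℕ => ((n + 2 : ℕ) : ℝ) * ‖a (n + 2)‖ * x ^ (n + 2)) α ∧
      HasSum (fun n : ℕ => ((n + 1 : ℕ) : ℝ) * ‖b (n + 1)‖ * x ^ (n + 1)) β ∧ α + β < x := by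
  have hx := ofReal_mem_unitDisk h0.le h1
  have sa := (hasSum_re_of_eq_ofReal (c := fun n => ((n + 2 : ℕ) : ℝ) * ‖a (n + 2)‖ * x ^ (n + 1))
    (hf.hasSum_deriv_left hh hx) fun n => by push_cast; rfl).1
  have sb := (hasSum_re_of_eq_ofReal (c := fun n => ((n + 1 : ℕ) : ℝ) * ‖b (n + 1)‖ * x ^ n)
    (hf.hasSum_deriv_right hx) fun n => by push_cast; rfl).1
  refine ⟨_, _, by simpa [pow_succ, mul_assoc] using sa.mul_right x,
    by simpa [pow_succ, mul_assoc] using sb.mul_right x, ?_⟩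
  have := hf.re_deriv_lt hh hs h0.le h1
  simp
  nlinarith

/-- With `q = f z` and `p = z h' - conj (z g')`, the claim `Re (q * conj p) > 0` amounts to `‖p - q‖
< ‖p + q‖`. Both sides are estimated termwise by the real series at `‖z‖`. -/
lemma HasSignedForm.re_pos (hf : HasSignedForm h g a b)
    (hh : DifferentiableOn ℂ h unitDisk) (hs : SensePreserving h g)
    {z : ℂ} (hz : z ∈ unitDisk) (hz0 : z ≠ 0) :
    0 < ((h z + conj (g z)) * conj (z * deriv h z - conj (z * deriv g z))).re := by
  have hρ1 : ‖z‖ < 1 := by simpa [unitDisk] using hz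
  have hρ0 : 0 < ‖z‖ := norm_pos_iff.2 hz0
  obtain ⟨α, β, hα, hβ, hlt⟩ := hf.exists_hasSum_lt hh hs hρ0 hρ1
  have hx := ofReal_mem_unitDisk hρ0.le hρ1
  have hA := (hasSum_re_of_eq_ofReal (c := fun n => ‖a (n + 2)‖ * ‖z‖ ^ (n + 2))
    (hf _ hx).1 fun n => by push_cast; rfl).1
  have hB := (hasSum_re_of_eq_ofReal (c := fun n => ‖b (n + 1)‖ * ‖z‖ ^ (n + 1))
    (hf _ hx).2 fun n => by push_cast; rfl).1
  set σ := ((‖z‖ : ℂ) - h ‖z‖).re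
  set τ := (g ‖z‖).re
  have sa := (hf.hasSum_deriv_left hh hz).mul_right z
  have sb := (hf.hasSum_deriv_right hz).mul_right z
  have n1 := (sa.add (hf z hz).1).norm_le_of_bounded (hα.add hA) fun n => by
    refine (norm_add_le _ _).trans (le_of_eq ?_)
    simp only [norm_mul, norm_pow, Complex.norm_natCast, Complex.norm_real, norm_norm]
    ring
  have n2 := (sa.sub (hf z hz).1).norm_le_of_bounded (hα.sub hA) fun n => by
    rw [show ((n + 2 : ℕ) : ℂ) * (‖a (n + 2)‖ : ℂ) * z ^ (n + 1) * z - ‖a (n + 2)‖ * z ^ (n + 2)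
      = (n + 1 : ℕ) * (‖a (n + 2)‖ * z ^ (n + 2)) by push_cast; ring]
    rw [norm_mul, norm_mul, norm_pow, Complex.norm_natCast, Complex.norm_real, norm_norm]
    push_cast
    exact le_of_eq (by ring)
  have n3 := (sb.add (hf z hz).2).norm_le_of_bounded (hβ.add hB) fun n => by
    refine (norm_add_le _ _).trans (le_of_eq ?_)
    simp only [norm_mul, norm_pow, Complex.norm_natCast, Complex.norm_real, norm_norm]
    ring
  have n4 := (sb.sub (hf z hz).2).norm_le_of_bounded (hβ.sub hB) fun n => by
    rw [show ((n + 1 : ℕ) : ℂ) * (‖b (n + 1)‖ : ℂ) * z ^ n * z - ‖b (n + 1)‖ * z ^ (n + 1)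
      = n * (‖b (n + 1)‖ * z ^ (n + 1)) by push_cast; ring]
    rw [norm_mul, norm_mul, norm_pow, Complex.norm_natCast, Complex.norm_real, norm_norm]
    push_cast
    exact le_of_eq (by ring)
  set p := z * deriv h z - conj (z * deriv g z) with hp
  set q := h z + conj (g z) with hq
  have hsub : ‖p - q‖ ≤ (α - σ) + (β + τ) := by
    have e : p - q = -((1 - deriv h z) * z - (z - h z)) - conj (deriv g z * z + g z) := by
      simp only [hp, hq, map_add, map_mul]; ring
    rw [e]
    refine (norm_sub_le _ _).trans ?_
    rw [norm_neg, RCLike.norm_conj]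
    exact add_le_add n2 n3
  have hadd : 2 * ‖z‖ - (α + σ) - (β - τ) ≤ ‖p + q‖ := by
    have e : 2 * z = (p + q) + ((1 - deriv h z) * z + (z - h z)) + conj (deriv g z * z - g z) := by
      simp only [hp, hq, map_sub, map_mul]; ring
    have e2 : 2 * ‖z‖ = ‖2 * z‖ := by simp
    have e3 := norm_add₃_le (a := p + q) (b := (1 - deriv h z) * z + (z - h z))
      (c := conj (deriv g z * z - g z))
    rw [← e, ← e2, RCLike.norm_conj] at e3
    linarith
  -- `σ` and `τ` cancel between the two bounds, leaving `α + β < ‖z‖`.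
  have hcmp : ‖p - q‖ < ‖p + q‖ := by linarith
  have hsq : ‖p - q‖ ^ 2 < ‖p + q‖ ^ 2 := by gcongr
  rw [← Complex.normSq_eq_norm_sq, ← Complex.normSq_eq_norm_sq, Complex.normSq_sub p q,
    Complex.normSq_add p q] at hsq
  have e : (q * conj p).re = (p * conj q).re := by
    simp only [Complex.mul_re, Complex.conj_re, Complex.conj_im]; ring
  rw [e]
  linarith

/-- The segment from the origin to a value taken on a closed disk consists of such values. -/
lemma HasSignedForm.exists_preimage_smul (hf : HasSignedForm h g a b)
    (hh : DifferentiableOn ℂ h unitDisk) (hg : DifferentiableOn ℂ g unitDisk)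
    (hs : SensePreserving h g) {z : ℂ} (hz : z ∈ unitDisk) {t : ℝ} (ht : t ∈ Set.Icc (0 : ℝ) 1) :
    ∃ w : ℂ, ‖w‖ ≤ ‖z‖ ∧ h w + conj (g w) = t * (h z + conj (g z)) := by
  set F : ℂ → ℂ := fun w => h w + conj (g w) with hF
  have hz1 : ‖z‖ < 1 := by simpa [unitDisk] using hz
  have hsub : closedBall (0 : ℂ) ‖z‖ ⊆ unitDisk := closedBall_subset_ball hz1
  have hcont : ContinuousOn F unitDisk :=
    hh.continuousOn.add (Complex.continuous_conj.comp_continuousOn hg.continuousOn)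
  have hF0 : F 0 = 0 := by
    have h0 : (0 : ℂ) ∈ unitDisk := by simp [unitDisk]
    have e1 := eq_zero_of_hasSum_zero_pow (k := 1) (hf 0 h0).1
    have e2 := eq_zero_of_hasSum_zero_pow (k := 0) (hf 0 h0).2
    have e3 : h 0 = 0 := by simpa using e1
    simp [hF, e2, e3]
  set S : Set ℝ := (fun x : ℝ => (x : ℂ) * F z) ⁻¹' (F '' closedBall 0 ‖z‖) with hS
  have hclosed : IsClosed S :=
    ((isCompact_closedBall _ _).image_of_continuousOn (hcont.mono hsub)).isClosed.preimage
      (by fun_prop)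
  have hall : Set.Icc 0 1 ⊆ S := by
    -- Continuity induction downwards from `1`: `S` is closed and extends to the left of each of its
    -- points in `(0, 1]`.
    refine (hclosed.inter isClosed_Icc).Icc_subset_of_forall_exists_lt
      ⟨z, by simp, by simp⟩ ?_
    rintro x ⟨⟨w, hw, hwx⟩, hx0, -⟩ y hy
    rw [mem_closedBall_zero_iff] at hw
    have hwD : w ∈ unitDisk := hsub (by simpa using hw)
    have hnear : ∀ᶠ x' : ℝ in 𝓝[<] x, x' ∈ S := by
      by_cases hw0 : w = 0
      · have hFz : F z = 0 := by
          rw [hw0, hF0] at hwx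
          simpa [hx0.ne'] using hwx.symm
        exact Eventually.of_forall fun x' => ⟨0, by simp, by simp [hF0, hFz]⟩
      · have hp := hf.re_pos hh hs hwD hw0
        have hwx' : h w + conj (g w) = x * F z := hwx
        rw [hwx', mul_assoc, Complex.re_ofReal_mul] at hp
        filter_upwards [eventually_exists_preimage_norm_le hh hg hwD (hs w hwD)
          (pos_of_mul_pos_right hp hx0.le) hwx'] with x' hx'
        obtain ⟨w', hw', e⟩ := hx'
        exact ⟨w', by simpa using hw'.trans hw, e⟩
    obtain ⟨x', h1, h2⟩ := (hnear.and (Ico_mem_nhdsLT hy)).exists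
    exact ⟨x', h1, h2⟩
  obtain ⟨w, hw, e⟩ := hall ht
  exact ⟨w, by simpa using hw, e⟩

/-- The coefficient bound for sense-preserving mappings of the signed form. -/
lemma HasSignedForm.sum_range_le (hf : HasSignedForm h g a b)
    (hh : DifferentiableOn ℂ h unitDisk) (hs : SensePreserving h g) (N : ℕ) :
    ∑ n ∈ Finset.range N, ((n + 2 : ℕ) : ℝ) * ‖a (n + 2)‖ +
      ∑ n ∈ Finset.range (N + 1), ((n + 1 : ℕ) : ℝ) * ‖b (n + 1)‖ ≤ 1 := by
  set P : ℝ → ℝ := fun x => ∑ n ∈ Finset.range N, ((n + 2 : ℕ) : ℝ) * ‖a (n + 2)‖ * x ^ (n + 2) +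
      ∑ n ∈ Finset.range (N + 1), ((n + 1 : ℕ) : ℝ) * ‖b (n + 1)‖ * x ^ (n + 1) with hP
  have hlim : Tendsto P (𝓝[<] 1) (𝓝 (P 1)) :=
    (by fun_prop : Continuous P).continuousAt.tendsto.mono_left nhdsWithin_le_nhds
  have hle : P 1 ≤ 1 := by
    -- For `x < 1` the partial sums stay below the full sums, hence below `x`.
    refine le_of_tendsto hlim ?_
    filter_upwards [Ioo_mem_nhdsLT (zero_lt_one' ℝ)] with x hx
    obtain ⟨α, β, hα, hβ, hlt⟩ := hf.exists_hasSum_lt hh hs hx.1 hx.2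
    have hx0 := hx.1
    have h1 := sum_le_hasSum (Finset.range N) (fun n _ => by positivity) hα
    have h2 := sum_le_hasSum (Finset.range (N + 1)) (fun n _ => by positivity) hβ
    simp only [hP]
    linarith [hx.2]
  simpa [hP] using hle

end SignedForm

/-! ### Boundary of the image disks and conclusion -/

/-- The image of a disk bounds the image of its circle under a univalent open mapping. -/
lemma frontier_image_ball {f : ℂ → ℂ} {r : ℝ} (hr : r ≠ 0)
    (hc : ContinuousOn f (closedBall 0 r)) (hi : Set.InjOn f (closedBall 0 r))
    (ho : IsOpen (f '' ball 0 r)) : frontier (f '' ball 0 r) = f '' sphere 0 r := by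
  have hcl : closure (f '' ball 0 r) = f '' closedBall 0 r := by
    refine Set.Subset.antisymm (closure_minimal (Set.image_mono ball_subset_closedBall)
      ((isCompact_closedBall _ _).image_of_continuousOn hc).isClosed) ?_
    rw [← closure_ball (0 : ℂ) hr] at hc ⊢
    exact hc.image_closure
  rw [ho.frontier_eq, hcl, ← closedBall_sdiff_ball, hi.image_sdiff_subset ball_subset_closedBall]

end HarmonicSpiral

open HarmonicSpiral in
theorem mainTheorem4 (lam : ℝ) (hlam : lam ∈ Set.Ioo (-(Real.pi / 2)) (Real.pi / 2))
    (f h g : ℂ → ℂ) (a b : ℕ → ℂ)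
    (hf : f ∈ HarmonicSpiral.classSPH' lam)
    (hrep : HarmonicSpiral.IsCanonicalRep f h g)
    (hform : HarmonicSpiral.HasSignedForm h g a b)
    (ha1 : a 1 = 1) :
    (Summable (fun n : ℕ => ((n + 1 : ℕ) : ℝ) * ‖a (n + 1)‖ + ((n + 1 : ℕ) : ℝ) * ‖b (n + 1)‖) ∧
      ∑' n : ℕ, (((n + 1 : ℕ) : ℝ) * ‖a (n + 1)‖ + ((n + 1 : ℕ) : ℝ) * ‖b (n + 1)‖) ≤ 2) ∧
    f ∈ HarmonicSpiral.classSTH' := by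
  obtain ⟨hH', hinj, hspiral⟩ := hf
  obtain ⟨h₀, g₀, a₀, b₀, hrep₀, hs₀, -⟩ := hH'.1
  have hs : SensePreserving h g := hs₀.of_isCanonicalRep hrep₀ hrep
  obtain ⟨hh, hg, hfeq⟩ := hrep
  refine ⟨?_, hH', ?_, hinj⟩
  · have hnn : ∀ n : ℕ, 0 ≤ ((n + 1 : ℕ) : ℝ) * ‖a (n + 1)‖ + ((n + 1 : ℕ) : ℝ) * ‖b (n + 1)‖ :=
      fun n => by positivity
    have hle : ∀ N, ∑ n ∈ Finset.range N,
        (((n + 1 : ℕ) : ℝ) * ‖a (n + 1)‖ + ((n + 1 : ℕ) : ℝ) * ‖b (n + 1)‖) ≤ 2 := by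
      intro N
      -- One more term is added so that, once `a 1 = 1` is split off, the indices match the bound by
      -- `1`; the total is then `2`.
      refine (Finset.sum_le_sum_of_subset_of_nonneg (Finset.range_mono N.le_succ)
        fun n _ _ => hnn n).trans ?_
      have := hform.sum_range_le hh hs N
      rw [Finset.sum_add_distrib, Finset.sum_range_succ']
      simp only [zero_add, ha1, norm_one, Nat.cast_one, mul_one]
      linarith
    exact ⟨summable_of_sum_range_le hnn hle, Real.tsum_le_of_sum_range_le hnn hle⟩
  · intro r hr0 hr1
    have hsub : closedBall (0 : ℂ) r ⊆ unitDisk := closedBall_subset_ball hr1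
    have hcont : ContinuousOn f (closedBall 0 r) :=
      ((hh.continuousOn.add (Complex.continuous_conj.comp_continuousOn hg.continuousOn)).congr
        hfeq).mono hsub
    obtain ⟨ho, hconn, h0, -⟩ := hspiral r hr0 hr1
    refine ⟨hinj.mono (sphere_subset_closedBall.trans hsub), f '' ball 0 r,
      ⟨ho, hconn, h0, starConvex_zero_iff.2 ?_⟩,
      ((isCompact_closedBall (0 : ℂ) r).image_of_continuousOn hcont).isBounded.subset
        (Set.image_mono ball_subset_closedBall),
      frontier_image_ball hr0.ne' hcont (hinj.mono hsub) ho⟩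
    rintro _ ⟨z, hz, rfl⟩ t ht0 ht1
    have hzD := hsub (ball_subset_closedBall hz)
    obtain ⟨w, hw, e⟩ := hform.exists_preimage_smul hh hg hs hzD ⟨ht0, ht1⟩
    have hwr : w ∈ ball (0 : ℂ) r := by
      rw [mem_ball_zero_iff] at hz ⊢
      exact hw.trans_lt hz
    refine ⟨w, hwr, ?_⟩
    rw [hfeq w (hsub (ball_subset_closedBall hwr)), e, ← hfeq z hzD, Complex.real_smul]
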